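/- Let $G$ be a locally compact Hausdorff abelian group (written additively) that is compactly generated, i.e. generated as a group by some compact neighbourhood of $0$. A set $A\subseteq G$ is relatively dense if $G=\bigcup_{x\in A}(x+K)$ for some compact neighbourhood $K$ of $0$. Let $\Lambda\subseteq G$ be a Delone set: it is relatively dense, and there is an open neighbourhood $U$ of $0$ such that $(x+U)\cap(y+U)=\emptyset$ for all distinct $x,y\in\Lambda$. Assume that $\Lambda$ has finite local complexity: for every compact $K\subseteq G$ the family $\{(-x+\Lambda)\cap K : x\in\Lambda\}$ is finite. Let $\delta_\Lambda=\sum_{x\in\Lambda}\delta_x$ be the Dirac comb of $\Lambda$. Then the following are equivalent: (i) $\Lambda$ is completely periodic, i.e. the set of periods $\{t\in G : t+\Lambda=\Lambda\}$ is relatively dense in $G$. (ii) $\delta_\Lambda$ is strongly almost periodic, i.e. $\delta_\Lambda$ is translation bounded (for some nonempty open relatively compact $V\subseteq G$ one has $\sup_{t\in G}\delta_\Lambda(t+V)<\infty$) and, for every continuous compactly supported $\varphi: G\to\mathbb{C}$, the function $f(s)=\int_G \varphi(s-u)\,d\delta_\Lambda(u)=\sum_{x\in\Lambda}\varphi(s-x)$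 is Bohr almost periodic: $f$ is continuous and bounded, and for every $\varepsilon>0$ the set $\{t\in G : \sup_{s\in G}|f(s-t)-f(s)|\le\varepsilon\}$ is relatively dense in $G$. -/

import Mathlib

open MeasureTheory Topology
open scoped Pointwise

namespace AperiodicOrder

/-- A topological (additive) group is compactly generated if it is generated, as a group, by a
compact neighbourhood of the identity. -/
def IsCompactlyGenerated (G : Type*) [AddGroup G] [TopologicalSpace G] : Prop :=
  ∃ W : Set G, IsCompact W ∧ W ∈ 𝓝 (0 : G) ∧ AddSubgroup.closure W = ⊤

section PointSets

variable {G : Type*} [AddCommGroup G] [TopologicalSpace G]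

/-- `Λ` is uniformly discrete: for some open neighbourhood `U` of the identity the sets `x + U`,
`x ∈ Λ`, are pairwise disjoint. -/
def IsUniformlyDiscrete (Λ : Set G) : Prop :=
  ∃ U : Set G, IsOpen U ∧ (0 : G) ∈ U ∧
    ∀ x ∈ Λ, ∀ y ∈ Λ, x ≠ y → (x +ᵥ U) ∩ (y +ᵥ U) = ∅

/-- `A` is relatively dense: for some compact neighbourhood `K` of the identity the sets `x + K`,
`x ∈ A`, cover `G`. -/
def IsRelativelyDense (A : Set G) : Prop :=
  ∃ K : Set G, IsCompact K ∧ K ∈ 𝓝 (0 : G) ∧ ⋃ x ∈ A, (x +ᵥ K) = Set.univ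

/-- A Delone set is a uniformly discrete and relatively dense set. -/
structure IsDelone (Λ : Set G) : Prop where
  uniformlyDiscrete : IsUniformlyDiscrete Λ
  relativelyDense : IsRelativelyDense Λ

/-- Finite local complexity: for every compact `K` there are only finitely many patches
`(-x + Λ) ∩ K` with `x ∈ Λ`. -/
def HasFiniteLocalComplexity (Λ : Set G) : Prop :=
  ∀ K : Set G, IsCompact K → {P : Set G | ∃ x ∈ Λ, P = (-x +ᵥ Λ) ∩ K}.Finite

/-- The set of periods of `Λ`. -/
def periods (Λ : Set G) : Set G := {t : G | t +ᵥ Λ = Λ}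

/-- `Λ` is completely periodic (crystalline) if its periods form a relatively dense set. -/
def IsCompletelyPeriodic (Λ : Set G) : Prop := IsRelativelyDense (periods Λ)

/-- Bohr almost periodicity: `f` is a bounded continuous function such that for each `ε > 0` the
set of `t` with `‖δ_t ∗ f - f‖_∞ ≤ ε` is relatively dense, where `(δ_t ∗ f) s = f (s - t)`. -/
structure IsBohrAlmostPeriodic (f : G → ℂ) : Prop where
  continuous : Continuous f
  bounded : ∃ C : ℝ, ∀ s, ‖f s‖ ≤ C
  relativelyDense_almostPeriods :
    ∀ ε : ℝ, 0 < ε → IsRelativelyDense {t : G | ∀ s : G, ‖f (s - t) - f s‖ ≤ ε}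

end PointSets

section Measures

variable {G : Type*} [AddCommGroup G] [TopologicalSpace G] [MeasurableSpace G]

/-- The Dirac comb `δ_Λ = ∑_{x ∈ Λ} δ_x`. -/
noncomputable def diracComb (Λ : Set G) : Measure G :=
  Measure.sum fun x : Λ => Measure.dirac (x : G)

/-- A (nonnegative) measure `ν` is translation bounded if for some nonempty open relatively compact
set `V` the numbers `ν (t + V)` are bounded uniformly in `t`. -/
def IsTranslationBounded (ν : Measure G) : Prop :=
  ∃ V : Set G, IsOpen V ∧ V.Nonempty ∧ IsCompact (closure V) ∧
    ∃ C : NNReal, ∀ t : G, ν (t +ᵥ V) ≤ C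

/-- The convolution `(ν ∗ φ) s = ∫ φ (s - u) dν(u)`. -/
noncomputable def convMeasure (ν : Measure G) (φ : G → ℂ) : G → ℂ :=
  fun s => ∫ u, φ (s - u) ∂ν

/-- `ν` is strongly almost periodic: it is translation bounded, and `ν ∗ φ` is Bohr almost periodic
for every continuous compactly supported `φ : G → ℂ`. -/
structure IsStronglyAlmostPeriodic (ν : Measure G) : Prop where
  translationBounded : IsTranslationBounded ν
  almostPeriodic : ∀ φ : G → ℂ, Continuous φ → HasCompactSupport φ →
    IsBohrAlmostPeriodic (convMeasure ν φ)

end Measures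

end AperiodicOrder

/-!
If the periods of `Λ` are relatively dense, then every function `δ_Λ ∗ φ` is continuous (it is
locally a finite sum), invariant under the periods and hence bounded (each of its values is attained
on one fixed compact set), and each period is an `ε`-almost period for every `ε`. Translation
boundedness is immediate from uniform discreteness.

Conversely, finite local complexity makes `Λ - Λ` locally finite
(`HasFiniteLocalComplexity.finite_sub_inter`). Let `f = δ_Λ ∗ φ` with `φ` a bump function at `0`,
supported in a small compact neighbourhood `N` of `0` and in `-N`; then `f = 1` on `Λ`, and `f`
vanishes outside `Λ + N`. If `t` is a `1/2`-almost period of `f`, then `-t` and `t` therefore move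
each point of `Λ` into `Λ + N`; after a correction of `t` by an element of `N`, one point of `Λ` is
moved exactly into `Λ` and all the others into `Λ + (N - N)`. As `G` is compactly generated and `Λ`
is relatively dense, any two points of `Λ` are joined by a chain in `Λ` whose steps lie in a fixed
compact set `C` (`exists_isCompact_chain_induction`). The finitely many elements of `Λ - Λ` near `C`
do not differ by a nonzero element of `N - N`, so exactness propagates along chains
(`add_mem_of_approx`), and the corrected `t` is a period. Thus every `1/2`-almost period lies within
the compact set `N` of a period.
-/

namespace AperiodicOrder

section Algebra

variable {G : Type*} [AddCommGroup G]

/-! ### From approximate to exact periods -/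

/-- A translation `t` that moves each point of `Λ` into `Λ + D`, and one point exactly into `Λ`,
maps `Λ` into itself, provided that `C` connects `Λ` and that the elements of `Λ - Λ` in `C` and in
`C - D` differ by an element of `D` only if they coincide. -/
theorem add_mem_of_approx {Λ C D : Set G}
    (hC : ∀ A : Set G, ∀ x₀ ∈ A,
      (∀ x ∈ Λ, ∀ y ∈ Λ, x ∈ A → y - x ∈ C → y ∈ A) → x₀ ∈ Λ → Λ ⊆ A)
    (hD : ∀ a ∈ (Λ - Λ) ∩ C, ∀ b ∈ (Λ - Λ) ∩ (C - D), a - b ∈ D → a = b)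
    {t x₀ : G} (hx₀ : x₀ ∈ Λ) (ht₀ : x₀ + t ∈ Λ)
    (ht : ∀ x ∈ Λ, ∃ y ∈ Λ, x + t - y ∈ D) : ∀ x ∈ Λ, x + t ∈ Λ := by
  refine hC {x | x + t ∈ Λ} x₀ ht₀ (fun x hx y hy hxt hyx => ?_) hx₀
  obtain ⟨z, hz, hzD⟩ := ht y hy
  have hdiff : y - x - (z - (x + t)) = y + t - z := by abel
  have heq : y - x = z - (x + t) := by
    refine hD _ ⟨⟨y, hy, x, hx, rfl⟩, hyx⟩ _ ⟨⟨z, hz, x + t, hxt, rfl⟩, ?_⟩ (hdiff ▸ hzD)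
    refine ⟨y - x, hyx, _, hzD, ?_⟩
    simp only
    abel
  have hyz : y + t = z := by
    rw [heq, sub_self] at hdiff
    exact (sub_eq_zero.1 hdiff.symm)
  rw [Set.mem_ofPred_eq, hyz]
  exact hz

theorem mem_periods_of_add_mem {Λ : Set G} {t : G} (h : ∀ x ∈ Λ, x + t ∈ Λ)
    (h' : ∀ x ∈ Λ, x + -t ∈ Λ) : t ∈ periods Λ := by
  refine Set.Subset.antisymm ?_ fun x hx => ⟨x + -t, h' x hx, by simp⟩
  rintro _ ⟨x, hx, rfl⟩
  simpa [add_comm] using h x hx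

end Algebra

section PointSets

variable {G : Type*} [AddCommGroup G] [TopologicalSpace G]

/-! ### Relatively dense and uniformly discrete sets -/

theorem isRelativelyDense_iff {A : Set G} :
    IsRelativelyDense A ↔
      ∃ K : Set G, IsCompact K ∧ K ∈ 𝓝 (0 : G) ∧ ∀ g : G, ∃ x ∈ A, g - x ∈ K := by
  simp only [IsRelativelyDense, Set.eq_univ_iff_forall, Set.mem_iUnion,
    Set.mem_vadd_set_iff_neg_vadd_mem, vadd_eq_add, exists_prop, neg_add_eq_sub]

theorem IsRelativelyDense.mono {A B : Set G} (hA : IsRelativelyDense A) (hAB : A ⊆ B) :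
    IsRelativelyDense B := by
  rw [isRelativelyDense_iff] at hA ⊢
  obtain ⟨K, hK, hK0, h⟩ := hA
  exact ⟨K, hK, hK0, fun g => (h g).imp fun x hx => ⟨hAB hx.1, hx.2⟩⟩

theorem IsRelativelyDense.nonempty {A : Set G} (hA : IsRelativelyDense A) : A.Nonempty := by
  obtain ⟨K, -, -, h⟩ := isRelativelyDense_iff.1 hA
  obtain ⟨x, hx, -⟩ := h 0
  exact ⟨x, hx⟩

/-- No translate of a suitable neighbourhood of `0` contains two points of a uniformly discrete set.
-/
theorem IsUniformlyDiscrete.exists_unique_nhds {Λ : Set G} (hΛ : IsUniformlyDiscrete Λ) :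
    ∃ U : Set G, IsOpen U ∧ (0 : G) ∈ U ∧
      ∀ t : G, ∀ x ∈ Λ, ∀ y ∈ Λ, x - t ∈ U → y - t ∈ U → x = y := by
  obtain ⟨U, hU, h0, h⟩ := hΛ
  refine ⟨U, hU, h0, fun t x hx y hy hxt hyt => ?_⟩
  by_contra hne
  -- The point `x + (y - t) = y + (x - t)` lies in both `x + U` and `y + U`.
  have hmem : x + y - t ∈ (x +ᵥ U) ∩ (y +ᵥ U) := by
    constructor
    · exact ⟨y - t, hyt, by simp only [vadd_eq_add]; abel⟩
    · exact ⟨x - t, hxt, by simp only [vadd_eq_add]; abel⟩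
  rw [h x hx y hy hne] at hmem
  exact hmem

variable [IsTopologicalAddGroup G]

theorem isCompact_sub {K L : Set G} (hK : IsCompact K) (hL : IsCompact L) : IsCompact (K - L) := by
  rw [sub_eq_add_neg]
  exact hK.add hL.neg

theorem IsUniformlyDiscrete.finite_inter {Λ K : Set G} (hΛ : IsUniformlyDiscrete Λ)
    (hK : IsCompact K) : (Λ ∩ K).Finite := by
  obtain ⟨U, hU, h0, h⟩ := hΛ.exists_unique_nhds
  obtain ⟨s, -, hs⟩ := hK.elim_nhds_subcover (fun k => {g | g - k ∈ U}) fun k _ =>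
    (hU.preimage (continuous_id.sub continuous_const)).mem_nhds (by simpa using h0)
  have hfin : (⋃ k ∈ s, Λ ∩ {g | g - k ∈ U}).Finite :=
    s.finite_toSet.biUnion fun k _ =>
      Set.Subsingleton.finite fun x hx y hy => h k x hx.1 y hy.1 hx.2 hy.2
  refine hfin.subset fun x hx => ?_
  obtain ⟨k, hk, hxk⟩ := Set.mem_iUnion₂.1 (hs hx.2)
  exact Set.mem_iUnion₂.2 ⟨k, hk, hx.1, hxk⟩

theorem HasFiniteLocalComplexity.finite_sub_inter {Λ K : Set G}
    (hFLC : HasFiniteLocalComplexity Λ) (hΛ : IsUniformlyDiscrete Λ) (hK : IsCompact K) :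
    ((Λ - Λ) ∩ K).Finite := by
  refine ((hFLC K hK).sUnion ?_).subset ?_
  · rintro _ ⟨x, -, rfl⟩
    have hfin := (hΛ.finite_inter (hK.image (continuous_const_add x))).image (fun y => -x + y)
    refine hfin.subset ?_
    rintro _ ⟨⟨y, hy, rfl⟩, hyK⟩
    exact ⟨y, ⟨hy, -x + y, hyK, by simp⟩, rfl⟩
  · rintro _ ⟨⟨y, hy, x, hx, rfl⟩, hyK⟩
    exact ⟨_, ⟨x, hx, rfl⟩, ⟨y, hy, by simp [sub_eq_neg_add]⟩, hyK⟩

/-! ### Chains in relatively dense sets -/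

/-- A relatively dense subset of a compactly generated group is connected by steps from a suitable
compact set: it is generated from any one of its points by such steps. -/
theorem exists_isCompact_chain_induction (hG : IsCompactlyGenerated G) {Λ : Set G}
    (hΛ : IsRelativelyDense Λ) :
    ∃ C : Set G, IsCompact C ∧ (0 : G) ∈ C ∧ ∀ A : Set G, ∀ x₀ ∈ A,
      (∀ x ∈ Λ, ∀ y ∈ Λ, x ∈ A → y - x ∈ C → y ∈ A) → x₀ ∈ Λ → Λ ⊆ A := by
  obtain ⟨W, hW, hW0, hgen⟩ := hG
  obtain ⟨K, hK, hK0, hcov⟩ := isRelativelyDense_iff.1 hΛ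
  have h0W := mem_of_mem_nhds hW0
  have h0K := mem_of_mem_nhds hK0
  refine ⟨(W ∪ -W) + (K - K), (hW.union hW.neg).add (isCompact_sub hK hK),
    ⟨0, Or.inl h0W, 0, ⟨0, h0K, 0, h0K, sub_zero 0⟩, add_zero 0⟩, ?_⟩
  intro A x₀ hx₀ hstep hx₀Λ
  -- Follow a word in the generators, choosing at each stage a point of `Λ` that is `K`-near.
  have key : ∀ g : G, ∀ y ∈ Λ, x₀ + g - y ∈ K → y ∈ A := by
    have step : ∀ g w : G, w ∈ W ∪ -W → (∀ y ∈ Λ, x₀ + g - y ∈ K → y ∈ A) →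
        ∀ y ∈ Λ, x₀ + (g + w) - y ∈ K → y ∈ A := by
      intro g w hw ih y hy hyK
      obtain ⟨x, hx, hxK⟩ := hcov (x₀ + g)
      refine hstep x hx y hy (ih x hx hxK) ⟨w, hw, _, ⟨_, hxK, _, hyK, rfl⟩, ?_⟩
      simp only
      abel
    intro g
    have hg : g ∈ AddSubgroup.closure W := hgen ▸ AddSubgroup.mem_top g
    induction hg using AddSubgroup.closure_induction_right with
    | zero =>
      intro y hy hyK
      refine hstep x₀ hx₀Λ y hy hx₀ ⟨0, Or.inl h0W, _, ⟨0, h0K, _, hyK, rfl⟩, ?_⟩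
      simp only
      abel
    | add_right g _ w hw ih => exact step g w (Or.inl hw) ih
    | add_neg_cancel g _ w hw ih => exact step g (-w) (Or.inr (by simpa using hw)) ih
  intro y hy
  exact key (y - x₀) y hy (by simpa using h0K)

/-! ### Small neighbourhoods and bump functions -/

theorem exists_bump [LocallyCompactSpace G] {N : Set G} (hN : N ∈ 𝓝 (0 : G)) :
    ∃ φ : G → ℂ, Continuous φ ∧ HasCompactSupport φ ∧ φ 0 = 1 ∧ ∀ x, φ x ≠ 0 → x ∈ N := by
  obtain ⟨f, hf1, hf0, hfc, -⟩ := exists_continuous_one_zero_of_isCompact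
    (isCompact_singleton (x := (0 : G))) (isOpen_interior (s := N)).isClosed_compl
    (Set.disjoint_singleton_left.2 fun h => h (mem_interior_iff_mem_nhds.2 hN))
  refine ⟨fun x => (f x : ℂ), by fun_prop, hfc.comp_left (g := fun r : ℝ => (r : ℂ)) (by simp),
    by simpa using hf1 rfl, fun x hx => ?_⟩
  by_contra hxN
  exact hx (by simpa using hf0 (fun hmem => hxN (interior_subset hmem)))

/-- Small neighbourhoods `N` of `0` for which `N - N` lies in `W` and contains no nonzero element of
a given finite set. -/
theorem exists_isCompact_nhds_sub [LocallyCompactSpace G] [T2Space G] {W E : Set G}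
    (hW : W ∈ 𝓝 (0 : G)) (hE : E.Finite) :
    ∃ N : Set G, IsCompact N ∧ N ∈ 𝓝 (0 : G) ∧ N - N ⊆ W ∧ ∀ e ∈ E, e ∈ N - N → e = 0 := by
  have hE' : (E \ {0})ᶜ ∈ 𝓝 (0 : G) :=
    (hE.subset Set.sdiff_subset).isClosed.isOpen_compl.mem_nhds (by simp)
  obtain ⟨V, hV, hVsub⟩ := exists_nhds_half_neg (Filter.inter_mem hW hE')
  obtain ⟨N, hN0, hNV, hN⟩ := local_compact_nhds hV
  have hsub : N - N ⊆ W ∩ (E \ {0})ᶜ := by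
    rintro _ ⟨a, ha, b, hb, rfl⟩
    exact hVsub a (hNV ha) b (hNV hb)
  refine ⟨N, hN, hN0, hsub.trans Set.inter_subset_left, fun e he heN => ?_⟩
  by_contra hne
  exact (hsub heN).2 ⟨he, hne⟩

/-! ### Convolutions with the Dirac comb -/

theorem finite_support_conv {Λ : Set G} (hΛ : IsUniformlyDiscrete Λ) {φ : G → ℂ}
    (hφ : HasCompactSupport φ) (s : G) :
    (Function.support fun x : Λ => φ (s - x)).Finite := by
  have hK : IsCompact ((fun k => s - k) '' tsupport φ) :=
    IsCompact.image hφ (continuous_const.sub continuous_id)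
  refine Set.Finite.of_finite_image ((hΛ.finite_inter hK).subset ?_) Subtype.val_injective.injOn
  rintro _ ⟨x, hx, rfl⟩
  exact ⟨x.2, s - x, subset_tsupport φ hx, by simp⟩

end PointSets

section Measures

variable {G : Type*} [AddCommGroup G] [TopologicalSpace G] [IsTopologicalAddGroup G]
  [T2Space G] [MeasurableSpace G] [BorelSpace G]

theorem convMeasure_diracComb {Λ : Set G} (hΛ : IsUniformlyDiscrete Λ) {φ : G → ℂ}
    (hφ : Continuous φ) (hφc : HasCompactSupport φ) (s : G) :
    convMeasure (diracComb Λ) φ s = ∑ᶠ x : Λ, φ (s - x) := by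
  have hfin := finite_support_conv hΛ hφc s
  have hψ : Continuous fun u => φ (s - u) := by fun_prop
  have hψc : HasCompactSupport fun u => φ (s - u) :=
    hφc.comp_homeomorph (Homeomorph.subLeft s)
  have hint : Integrable (fun u => φ (s - u)) (diracComb Λ) := by
    refine ⟨(hψ.stronglyMeasurable_of_hasCompactSupport hψc).aestronglyMeasurable, ?_⟩
    rw [HasFiniteIntegral, diracComb, lintegral_sum_measure]
    simp only [lintegral_dirac]
    rw [tsum_eq_finsum (hfin.subset fun x hx => by simpa using hx)]
    rw [finsum_eq_sum_of_support_subset (s := hfin.toFinset) _ (fun x hx => by simpa using hx)]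
    exact ENNReal.sum_lt_top.2 fun x _ => enorm_lt_top
  unfold convMeasure
  rw [diracComb] at hint ⊢
  rw [integral_sum_measure hint]
  simp only [integral_dirac]
  exact tsum_eq_finsum hfin

theorem continuous_convMeasure_diracComb [LocallyCompactSpace G] {Λ : Set G}
    (hΛ : IsUniformlyDiscrete Λ) {φ : G → ℂ} (hφ : Continuous φ) (hφc : HasCompactSupport φ) :
    Continuous (convMeasure (diracComb Λ) φ) := by
  rw [funext (convMeasure_diracComb hΛ hφ hφc)]
  refine continuous_finsum (fun x => by fun_prop) fun s => ?_
  obtain ⟨N, hN, hNs⟩ := exists_compact_mem_nhds s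
  refine ⟨N, hNs, ?_⟩
  refine Set.Finite.of_finite_image
    ((hΛ.finite_inter (isCompact_sub hN hφc)).subset ?_) Subtype.val_injective.injOn
  rintro _ ⟨x, ⟨g, hg, hgN⟩, rfl⟩
  exact ⟨x.2, g, hgN, g - x, subset_tsupport φ hg, by simp⟩

theorem convMeasure_diracComb_sub_period {Λ : Set G}
    (hΛ : IsUniformlyDiscrete Λ) {φ : G → ℂ} (hφ : Continuous φ) (hφc : HasCompactSupport φ)
    {t : G} (ht : t ∈ periods Λ) (s : G) :
    convMeasure (diracComb Λ) φ (s - t) = convMeasure (diracComb Λ) φ s := by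
  rw [convMeasure_diracComb hΛ hφ hφc, convMeasure_diracComb hΛ hφ hφc,
    finsum_set_coe_eq_finsum_mem (f := fun x => φ (s - t - x)),
    finsum_set_coe_eq_finsum_mem (f := fun x => φ (s - x))]
  have hΛt : (fun x => t + x) '' Λ = Λ := ht
  conv_rhs => rw [← hΛt]
  rw [finsum_mem_image (add_right_injective t).injOn]
  simp only [sub_add_eq_sub_sub]

theorem exists_mem_of_convMeasure_diracComb_ne_zero {Λ : Set G} (hΛ : IsUniformlyDiscrete Λ)
    {φ : G → ℂ} (hφ : Continuous φ) (hφc : HasCompactSupport φ) {s : G}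
    (hs : convMeasure (diracComb Λ) φ s ≠ 0) : ∃ x ∈ Λ, φ (s - x) ≠ 0 := by
  by_contra! h
  refine hs ?_
  rw [convMeasure_diracComb hΛ hφ hφc]
  exact finsum_eq_zero_of_forall_eq_zero fun x => h x x.2

/-! ### Complete periodicity implies strong almost periodicity -/

theorem isTranslationBounded_diracComb [LocallyCompactSpace G] {Λ : Set G}
    (hΛ : IsUniformlyDiscrete Λ) : IsTranslationBounded (diracComb Λ) := by
  obtain ⟨U, hU, h0, h⟩ := hΛ.exists_unique_nhds
  obtain ⟨N, hN, hN0⟩ := exists_compact_mem_nhds (0 : G)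
  have hVo : IsOpen (U ∩ interior N) := hU.inter isOpen_interior
  refine ⟨U ∩ interior N, hVo, ⟨0, h0, mem_interior_iff_mem_nhds.2 hN0⟩,
    hN.closure_of_subset (Set.inter_subset_right.trans interior_subset), 1, fun t => ?_⟩
  rw [diracComb, Measure.sum_apply _ (hVo.vadd t).measurableSet]
  simp only [Measure.dirac_apply]
  -- A translate of `U` contains at most one point of `Λ`, so at most one summand is nonzero.
  by_cases hne : ∃ x : Λ, (x : G) ∈ t +ᵥ (U ∩ interior N)
  · obtain ⟨x, hx⟩ := hne
    have hmem : ∀ y : G, y ∈ t +ᵥ (U ∩ interior N) → y - t ∈ U := by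
      rintro _ ⟨v, hv, rfl⟩
      simpa using hv.1
    rw [tsum_eq_single x fun y hy => Set.indicator_of_notMem (fun hyV => hy
      (Subtype.ext (h t y y.2 x x.2 (hmem _ hyV) (hmem _ hx)))) _]
    simp [Set.indicator_of_mem hx]
  · push Not at hne
    simp [fun x : Λ => Set.indicator_of_notMem (hne x) (1 : G → ENNReal)]

theorem IsCompletelyPeriodic.isStronglyAlmostPeriodic [LocallyCompactSpace G] {Λ : Set G}
    (hΛ : IsUniformlyDiscrete Λ) (h : IsCompletelyPeriodic Λ) :
    IsStronglyAlmostPeriodic (diracComb Λ) := by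
  refine ⟨isTranslationBounded_diracComb hΛ, fun φ hφ hφc => ?_⟩
  have hcont := continuous_convMeasure_diracComb hΛ hφ hφc
  refine ⟨hcont, ?_, fun ε hε => IsRelativelyDense.mono h fun t ht s => ?_⟩
  · obtain ⟨K, hK, -, hcov⟩ := isRelativelyDense_iff.1 h
    obtain ⟨c, hc⟩ := hK.exists_bound_of_continuousOn hcont.continuousOn
    refine ⟨c, fun s => ?_⟩
    obtain ⟨t, ht, hst⟩ := hcov s
    rw [← convMeasure_diracComb_sub_period hΛ hφ hφc ht]
    exact hc _ hst
  · rw [convMeasure_diracComb_sub_period hΛ hφ hφc ht, sub_self, norm_zero]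
    exact hε.le

/-! ### Strong almost periodicity implies complete periodicity -/

theorem IsStronglyAlmostPeriodic.isCompletelyPeriodic [LocallyCompactSpace G]
    (hG : IsCompactlyGenerated G) {Λ : Set G} (hΛ : IsDelone Λ)
    (hFLC : HasFiniteLocalComplexity Λ) (h : IsStronglyAlmostPeriodic (diracComb Λ)) :
    IsCompletelyPeriodic Λ := by
  have hud := hΛ.uniformlyDiscrete
  obtain ⟨C, hC, h0C, hchain⟩ := exists_isCompact_chain_induction hG hΛ.relativelyDense
  obtain ⟨W, hW, hW0⟩ := exists_compact_mem_nhds (0 : G)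
  have h0W := mem_of_mem_nhds hW0
  have hF : ((Λ - Λ) ∩ (C - (W ∪ -W))).Finite :=
    hFLC.finite_sub_inter hud (isCompact_sub hC (hW.union hW.neg))
  set F := (Λ - Λ) ∩ (C - (W ∪ -W)) with hFdef
  obtain ⟨N, hN, hN0, hNW, hNF⟩ := exists_isCompact_nhds_sub hW0 (hF.sub hF)
  have h0N := mem_of_mem_nhds hN0
  have hNsub : N ⊆ N - N := fun n hn => ⟨n, hn, 0, h0N, sub_zero n⟩
  have hdiff : ∀ a ∈ (Λ - Λ) ∩ C, ∀ b ∈ (Λ - Λ) ∩ (C - (N - N)), a - b ∈ N - N → a = b := by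
    rintro a ⟨ha, haC⟩ b ⟨hb, hbC⟩ hab
    refine sub_eq_zero.1 (hNF _ ⟨a, ⟨ha, a, haC, 0, Or.inl h0W, sub_zero a⟩, b, ⟨hb, ?_⟩, rfl⟩ hab)
    exact Set.sub_subset_sub_left (hNW.trans Set.subset_union_left) hbC
  -- Distinct points of `Λ` do not differ by an element of `N`.
  have hsep : ∀ x ∈ Λ, ∀ y ∈ Λ, x - y ∈ N → x = y := by
    intro x hx y hy hxy
    have h0F : (0 : G) ∈ F :=
      ⟨⟨x, hx, x, hx, sub_self x⟩, 0, h0C, 0, Or.inl h0W, sub_zero 0⟩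
    have hxyF : x - y ∈ F := by
      refine ⟨⟨x, hx, y, hy, rfl⟩, 0, h0C, -(x - y), Or.inr ?_, by simp⟩
      simpa using hNW (hNsub hxy)
    exact sub_eq_zero.1 (hNF _ ⟨x - y, hxyF, 0, h0F, sub_zero _⟩ (hNsub hxy))
  -- The support is made symmetric so that `t` and `-t` can be treated alike.
  obtain ⟨φ, hφ, hφc, hφ0, hφN⟩ :=
    exists_bump (Filter.inter_mem hN0 (neg_mem_nhds_zero G hN0))
  set f := convMeasure (diracComb Λ) φ with hf
  have hf1 : ∀ x ∈ Λ, f x = 1 := by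
    intro x hx
    rw [hf, convMeasure_diracComb hud hφ hφc, finsum_eq_single _ ⟨x, hx⟩, sub_self, hφ0]
    intro y hy
    by_contra hne
    exact hy (Subtype.ext (hsep x hx y y.2 (hφN _ hne).1).symm)
  have hnear : ∀ s, ∀ x ∈ Λ, ‖f s - f x‖ ≤ 1 / 2 → ∃ y ∈ Λ, s - y ∈ N ∩ -N := by
    intro s x hx hsx
    have hs : f s ≠ 0 := by
      intro h0
      rw [h0, hf1 x hx] at hsx
      norm_num at hsx
    exact (exists_mem_of_convMeasure_diracComb_ne_zero hud hφ hφc hs).imp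
      fun y hy => ⟨hy.1, hφN _ hy.2⟩
  obtain ⟨K, hK, hK0, hcov⟩ := isRelativelyDense_iff.1
    ((h.almostPeriodic φ hφ hφc).relativelyDense_almostPeriods (1 / 2) (by norm_num))
  obtain ⟨x₀, hx₀⟩ := hΛ.relativelyDense.nonempty
  refine isRelativelyDense_iff.2 ⟨K - N, isCompact_sub hK hN,
    Filter.mem_of_superset hK0 fun k hk => ⟨k, hk, 0, h0N, sub_zero k⟩, fun g => ?_⟩
  obtain ⟨t, ht, hgt⟩ := hcov g
  have hminus : ∀ x ∈ Λ, ∃ y ∈ Λ, x - t - y ∈ N ∩ -N := fun x hx => hnear _ x hx (ht x)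
  have hplus : ∀ x ∈ Λ, ∃ y ∈ Λ, x + t - y ∈ N ∩ -N := fun x hx =>
    hnear _ x hx (by simpa [norm_sub_rev] using ht (x + t))
  -- Correct the almost period `t` to `x₀ - y₀`, which moves `y₀` exactly to `x₀`.
  obtain ⟨y₀, hy₀, hy₀N⟩ := hminus x₀ hx₀
  refine ⟨x₀ - y₀, mem_periods_of_add_mem ?_ ?_, g - t, hgt, _, hy₀N.1, by simp only; abel⟩
  · refine add_mem_of_approx hchain hdiff hy₀ (by simpa using hx₀) fun x hx => ?_
    obtain ⟨y, hy, hyN⟩ := hplus x hx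
    exact ⟨y, hy, _, hy₀N.1, _, hyN.2, by simp only; abel⟩
  · refine add_mem_of_approx hchain hdiff hx₀ (by simpa using hy₀) fun x hx => ?_
    obtain ⟨y, hy, hyN⟩ := hminus x hx
    exact ⟨y, hy, _, hyN.1, _, hy₀N.1, by simp only; abel⟩

end Measures

end AperiodicOrder

theorem mainTheorem1 {G : Type*} [AddCommGroup G] [TopologicalSpace G] [IsTopologicalAddGroup G]
    [LocallyCompactSpace G] [T2Space G] [MeasurableSpace G] [BorelSpace G]
    (hG : AperiodicOrder.IsCompactlyGenerated G) (Λ : Set G)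
    (hΛ : AperiodicOrder.IsDelone Λ) (hFLC : AperiodicOrder.HasFiniteLocalComplexity Λ) :
    AperiodicOrder.IsCompletelyPeriodic Λ ↔
      AperiodicOrder.IsStronglyAlmostPeriodic (AperiodicOrder.diracComb Λ) :=
  ⟨fun h => h.isStronglyAlmostPeriodic hΛ.uniformlyDiscrete,
    fun h => h.isCompletelyPeriodic hG hΛ hFLC⟩
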